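/- Let $d\ge 1$ be an integer, let $0<s<d$, and let $m$ be a finite nonnegative Borel measure on $\mathbb{R}^d$. Set $$V_s(x)=\int_{\mathbb{R}^d}\frac{x-y}{|x-y|^{s+1}}\,dm(y),$$ which is an absolutely convergent integral for Lebesgue-almost every $x\in\mathbb{R}^d$ and defines a locally integrable vector field. Let $B_r(a)$ denote the ball of radius $r$ centered at $a$. A point $a\in\mathbb{R}^d$ is called a Lebesgue point of $V_s$ if there is a vector $\alpha\in\mathbb{R}^d$ with $$\lim_{r\to0^+}\frac{1}{|B_r(a)|}\int_{B_r(a)}|V_s(x)-\alpha|\,dx=0,$$ where $|B_r(a)|$ is the Lebesgue measure of $B_r(a)$; such an $\alpha$ is unique and is called the precise representative of $V_s$ at $a$. The principal value of $V_s$ at $a$ is $$\mathrm{p.v.}\,V_s(a)=\lim_{\varepsilon\to0^+}\int_{\mathbb{R}^d\setminus B_\varepsilon(a)}\frac{a-y}{|a-y|^{s+1}}\,dm(y),$$ whenever this limit exists in $\mathbb{R}^d$. Then, for every $a\in\mathbb{R}^d$, the point $a$ is a Lebesgue point of $V_s$ if and only if the principal value of $V_s$ exists at $a$ and $$\lim_{r\to0^+}\frac{m(B_r(a))}{r^s}=0.$$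 In that case, the precise representative of $V_s$ at $a$ equals $\mathrm{p.v.}\,V_s(a)$. -/

import Mathlib

open MeasureTheory Filter Topology Metric

namespace RieszField

/-- The vector kernel `z / |z|^(s+1)` on `ℝ^d`. -/
noncomputable def kernel {d : ℕ} (s : ℝ) (z : EuclideanSpace ℝ (Fin d)) :
    EuclideanSpace ℝ (Fin d) :=
  (‖z‖ ^ (s + 1))⁻¹ • z

/-- The vector field `V_s(x) = ∫ (x - y) / |x - y|^(s+1) dm(y)`. For a finite measure `m` and
`0 < s < d` it is an absolutely convergent integral at every `x` with `∫ |x - y|^(-s) dm(y) < ∞`,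
hence at Lebesgue-almost every `x`. -/
noncomputable def V {d : ℕ} (s : ℝ) (m : Measure (EuclideanSpace ℝ (Fin d)))
    (x : EuclideanSpace ℝ (Fin d)) : EuclideanSpace ℝ (Fin d) :=
  ∫ y, kernel s (x - y) ∂m

/-- `v` is the principal value of `V_s` at `a`: the limit as `ε → 0⁺` of the integrals of the kernel
over the complement of the ball of radius `ε` around `a`. For a finite measure the truncated kernel
is bounded, so these integrals always converge absolutely. -/
def HasPrincipalValue {d : ℕ} (s : ℝ) (m : Measure (EuclideanSpace ℝ (Fin d)))
    (a v : EuclideanSpace ℝ (Fin d)) : Prop :=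
  Tendsto (fun ε : ℝ => ∫ y in (ball a ε)ᶜ, kernel s (a - y) ∂m) (𝓝[>] 0) (𝓝 v)

/-- `α` is the precise representative of `f` at `a`: `f` is Lebesgue integrable on all small balls
around `a`, and the averages of `|f - α|` over `B_r(a)` tend to `0` as `r → 0⁺`. -/
def HasPreciseRepresentative {d : ℕ} (f : EuclideanSpace ℝ (Fin d) → EuclideanSpace ℝ (Fin d))
    (a α : EuclideanSpace ℝ (Fin d)) : Prop :=
  (∀ᶠ r : ℝ in 𝓝[>] 0, IntegrableOn f (ball a r) volume) ∧
    Tendsto (fun r : ℝ => ⨍ x in ball a r, ‖f x - α‖ ∂volume) (𝓝[>] 0) (𝓝 0)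

/-- `a` is a Lebesgue point of `f`: a precise representative of `f` exists at `a`. -/
def IsLebesguePoint {d : ℕ} (f : EuclideanSpace ℝ (Fin d) → EuclideanSpace ℝ (Fin d))
    (a : EuclideanSpace ℝ (Fin d)) : Prop :=
  ∃ α, HasPreciseRepresentative f a α

end RieszField

/-!
# Lebesgue points of Riesz fields

Write `K z = z / |z| ^ (s + 1)`, `V = K * m` and `P ε` for the integral of `K (a - y)` over
`|y - a| ≥ ε`. The density condition `m (B_r(a)) = o(r ^ s)` is what links the averages of `V` on
`B_r(a)` to the truncated integrals `P`.

*Under the density condition, `V` is close to `P (2r)` in mean on `B_r(a)`*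
(`tendsto_average_norm_V_sub_truncated`). The mass in `B_{2r}(a)` contributes at most a constant times
`r ^ (-s) m (B_{2r}(a))` on average. For the rest, `K` varies by at most `C r |y - a| ^ (-s - 1)`, and
`r ∫_{|y - a| ≥ 2r} |y - a| ^ (-s - 1) dm` tends to zero by a dyadic recursion
(`tendsto_rpow_mul_tail`). Hence a vector is the precise representative of `V` at `a` if and only if
it is the principal value.

*A Lebesgue point satisfies the density condition* (`tendsto_measureReal_ball_div_rpow`). The field
`V` is tested against the radial field `φ_r(x) = |x - a| ^ (-(2d - s + 1)) (x - a)`, cut off inside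
`B_r(a)`. It is odd about `a`, so `V` may be replaced by `V - α`, and the decay `|x - a| ^ (-(2d - s))`
is integrable at infinity; the same dyadic recursion, now for the measure `|V - α| dx`, gives
`r ^ (d - s) ∫ φ_r · V → 0`. By Fubini this integral is `∫ G_r dm` with
`G_r(y) = ∫ φ_r(x) · K (x - y) dx`, and `G_r ≥ c r ^ (-d)` on `B_{r/2}(a)`. The point is that `G_r ≥ 0`
everywhere (`integral_indicator_radialPairing_nonneg`), although the integrand is negative inside the
sphere with diameter `[a, y]`: the exponent of `φ_r` is the one for which the integrand without cut-off
is odd under inversion in that sphere (`radialPairing_inversion`), and the inversion carries outside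
points closer to `a`, so that the cut-off removes more of the negative part than of the positive one.
-/

namespace RieszField

variable {d : ℕ} {s : ℝ}

local notation "𝔼" => EuclideanSpace ℝ (Fin d)

/-! ### The kernel -/

lemma norm_kernel (hs : 0 < s) (z : 𝔼) : ‖kernel s z‖ = ‖z‖ ^ (-s) := by
  rcases eq_or_ne z 0 with rfl | hz
  · simp [kernel, Real.zero_rpow (neg_ne_zero.2 hs.ne')]
  · have hz' : 0 < ‖z‖ := norm_pos_iff.2 hz
    rw [kernel, norm_smul, Real.norm_of_nonneg (by positivity), Real.rpow_add hz', Real.rpow_neg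
      hz'.le, Real.rpow_one]
    field_simp

@[fun_prop]
lemma measurable_kernel : Measurable (kernel s : 𝔼 → 𝔼) := by
  unfold kernel
  fun_prop

lemma abs_rpow_neg_sub_le {q t p : ℝ} (hq : 0 < q) (ht : 0 < t) (hp : t / 2 ≤ p) :
    |p ^ (-q) - t ^ (-q)| ≤ q * (t / 2) ^ (-q - 1) * |p - t| := by
  have ht2 : 0 < t / 2 := by positivity
  have := (convex_Ici (t / 2)).norm_image_sub_le_of_norm_hasDerivWithin_le
    (f := fun x : ℝ => x ^ (-q)) (f' := fun x => -q * x ^ (-q - 1))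
    (C := q * (t / 2) ^ (-q - 1)) (x := t) (y := p) ?_ ?_ ?_ hp
  · simpa [Real.norm_eq_abs] using this
  · intro x hx
    exact (Real.hasDerivAt_rpow_const (Or.inl (ht2.trans_le hx).ne')).hasDerivWithinAt
  · intro x hx
    have hx0 : 0 < x := ht2.trans_le hx
    rw [norm_mul, norm_neg, Real.norm_of_nonneg hq.le, Real.norm_of_nonneg (by positivity)]
    exact mul_le_mul_of_nonneg_left
      (Real.rpow_le_rpow_of_nonpos ht2 hx (by linarith)) hq.le
  · exact Set.mem_Ici.2 (by linarith)

/-- The kernel is Lipschitz away from its singularity, with the constant dictated by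
homogeneity. -/
lemma norm_kernel_sub_le (hs : 0 < s) {u v : 𝔼} (h : ‖u - v‖ ≤ ‖v‖ / 2) :
    ‖kernel s u - kernel s v‖ ≤
      (2 ^ (s + 1) + (s + 1) * 2 ^ (s + 2)) * ‖u - v‖ * ‖v‖ ^ (-(s + 1)) := by
  rcases eq_or_ne v 0 with rfl | hv
  · have : u = 0 := by simpa using h
    simp [this]
  have ht : 0 < ‖v‖ := norm_pos_iff.2 hv
  have hp : ‖v‖ / 2 ≤ ‖u‖ := by
    have := norm_sub_norm_le v u
    rw [norm_sub_rev] at this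
    linarith
  have hu : 0 < ‖u‖ := by linarith
  have hdec : kernel s u - kernel s v =
      ‖u‖ ^ (-(s + 1)) • (u - v) + (‖u‖ ^ (-(s + 1)) - ‖v‖ ^ (-(s + 1))) • v := by
    simp only [kernel, Real.rpow_neg hu.le, Real.rpow_neg ht.le]
    module
  have h1 : ‖u‖ ^ (-(s + 1)) ≤ 2 ^ (s + 1) * ‖v‖ ^ (-(s + 1)) := by
    refine (Real.rpow_le_rpow_of_nonpos (by positivity) hp (by linarith)).trans_eq ?_
    rw [Real.div_rpow ht.le (by norm_num), Real.rpow_neg (by norm_num : (0 : ℝ) ≤ 2)]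
    field_simp
  have h2 := abs_rpow_neg_sub_le (q := s + 1) (by linarith) ht hp
  have h3 : (‖v‖ / 2) ^ (-(s + 1) - 1) * ‖v‖ = 2 ^ (s + 2) * ‖v‖ ^ (-(s + 1)) := by
    rw [Real.div_rpow ht.le (by norm_num), show -(s + 1) - 1 = -(s + 2) by ring,
      Real.rpow_neg (by norm_num : (0 : ℝ) ≤ 2), show -(s + 1) = -(s + 2) + 1 by ring,
      Real.rpow_add_one ht.ne']
    field_simp
  have h4 : |‖u‖ - ‖v‖| ≤ ‖u - v‖ := abs_norm_sub_norm_le u v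
  calc ‖kernel s u - kernel s v‖
      ≤ ‖u‖ ^ (-(s + 1)) * ‖u - v‖ + |‖u‖ ^ (-(s + 1)) - ‖v‖ ^ (-(s + 1))| * ‖v‖ := by
        rw [hdec]
        refine (norm_add_le _ _).trans_eq ?_
        rw [norm_smul, norm_smul, Real.norm_of_nonneg (by positivity), Real.norm_eq_abs]
    _ ≤ 2 ^ (s + 1) * ‖v‖ ^ (-(s + 1)) * ‖u - v‖ +
        (s + 1) * (‖v‖ / 2) ^ (-(s + 1) - 1) * ‖u - v‖ * ‖v‖ := by
        gcongr
        exact h2.trans (by gcongr)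
    _ = _ := by linear_combination (s + 1) * ‖u - v‖ * h3

/-! ### Tails of measures with small densities -/

/-- A measure whose mass `N r` on the ball of radius `r` is `o(r ^ p)` has weighted tails
`T r = ∫_{|x| ≥ r} |x| ^ (-(p + η))` of size `o(r ^ (-η))`. Only the dyadic recursion
between `N` and `T` matters. -/
lemma tendsto_rpow_mul_tail {N T : ℝ → ℝ} {p η : ℝ} (hη : 0 < η)
    (hN : Tendsto (fun r => N r / r ^ p) (𝓝[>] 0) (𝓝 0))
    (hT0 : ∀ r, 0 < r → 0 ≤ T r) (hT : ∀ r r', 0 < r → r ≤ r' → T r' ≤ T r)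
    (hrec : ∀ r, 0 < r → T r ≤ r ^ (-(p + η)) * N (2 * r) + T (2 * r)) :
    Tendsto (fun r => r ^ η * T r) (𝓝[>] 0) (𝓝 0) := by
  set θ : ℝ := 2 ^ (-η)
  have hθ0 : 0 < θ := by positivity
  have hθ1 : θ < 1 := Real.rpow_lt_one_of_one_lt_of_neg (by norm_num) (by linarith)
  have hθ2 : θ * 2 ^ η = 1 := by rw [← Real.rpow_add (by norm_num)]; simp
  set A : ℝ := 2 ^ p / (1 - θ)
  have hA : 2 ^ p + θ * A = A := by
    have : (1 - θ) ≠ 0 := by linarith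
    simp only [A]; field_simp; ring
  have hA0 : 0 < A := div_pos (by positivity) (by linarith)
  -- The recursion propagates a bound on `[δ / 2, δ]` to all smaller radii.
  have key : ∀ ε > 0, ∃ δ > 0, ∃ C, ∀ r, 0 < r → r ≤ δ → r ^ η * T r ≤ A * ε + r ^ η * C := by
    intro ε hε
    have := hN.eventually (gt_mem_nhds hε)
    rw [eventually_nhdsWithin_iff, Metric.eventually_nhds_iff] at this
    obtain ⟨δ₀, hδ₀, hb⟩ := this
    have hb' : ∀ r, 0 < r → r ≤ δ₀ / 2 → N r ≤ ε * r ^ p := by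
      intro r hr hrδ
      have := hb (y := r) (by simp [abs_of_pos hr]; linarith) hr
      rw [div_lt_iff₀ (by positivity)] at this
      exact this.le
    set δ := δ₀ / 2
    have hδ : 0 < δ := by positivity
    refine ⟨δ, hδ, T (δ / 2), ?_⟩
    have : ∀ n : ℕ, ∀ r, 0 < r → r ≤ δ → δ ≤ 2 ^ (n + 1) * r →
        r ^ η * T r ≤ A * ε + r ^ η * T (δ / 2) := by
      intro n
      have base : ∀ r, 0 < r → δ ≤ 2 * r → r ^ η * T r ≤ A * ε + r ^ η * T (δ / 2) := by
        intro r hr h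
        have h1 : T r ≤ T (δ / 2) := hT _ _ (by positivity) (by linarith)
        have h2 : r ^ η * T r ≤ r ^ η * T (δ / 2) := by gcongr
        nlinarith
      induction n with
      | zero => intro r hr _ h; exact base r hr (by simpa using h)
      | succ n ih =>
        intro r hr hrδ h
        rcases le_or_gt δ (2 * r) with h' | h'
        · exact base r hr h'
        have ih' := ih (2 * r) (by positivity) h'.le (by rw [pow_succ] at h; linarith)
        have hN' := hb' (2 * r) (by positivity) h'.le
        rw [Real.mul_rpow (by norm_num) hr.le] at ih' hN'
        have e1 : r ^ η * r ^ (-(p + η)) * r ^ p = 1 := by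
          rw [← Real.rpow_add hr, ← Real.rpow_add hr]; simp
        calc r ^ η * T r ≤ r ^ η * (r ^ (-(p + η)) * N (2 * r) + T (2 * r)) := by
              gcongr; exact hrec r hr
          _ ≤ r ^ η * (r ^ (-(p + η)) * (ε * (2 ^ p * r ^ p)) + T (2 * r)) := by gcongr
          _ = ε * 2 ^ p + θ * (2 ^ η * r ^ η * T (2 * r)) := by
              linear_combination (ε * 2 ^ p) * e1 - r ^ η * T (2 * r) * hθ2
          _ ≤ ε * 2 ^ p + θ * (A * ε + 2 ^ η * r ^ η * T (δ / 2)) := by gcongr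
          _ = A * ε + r ^ η * T (δ / 2) := by
              linear_combination ε * hA + r ^ η * T (δ / 2) * hθ2
    intro r hr hrδ
    obtain ⟨n, hn⟩ := pow_unbounded_of_one_lt (δ / r) (by norm_num : (1 : ℝ) < 2)
    refine this n r hr hrδ ?_
    rw [div_lt_iff₀ hr] at hn
    have : (2 : ℝ) ^ n * r ≤ 2 ^ (n + 1) * r := by gcongr <;> simp
    linarith
  rw [Metric.tendsto_nhds]
  intro ε hε
  obtain ⟨δ, hδ, C, hC⟩ := key (ε / (2 * A)) (by positivity)
  have hlim : Tendsto (fun r : ℝ => r ^ η * C) (𝓝[>] 0) (𝓝 0) := by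
    have : Tendsto (fun r : ℝ => r ^ η * C) (𝓝 0) (𝓝 (0 ^ η * C)) :=
      (Real.continuousAt_rpow_const _ _ (Or.inr hη.le)).tendsto.mul_const C
    rw [Real.zero_rpow hη.ne', zero_mul] at this
    exact this.mono_left nhdsWithin_le_nhds
  filter_upwards [hlim.eventually (gt_mem_nhds (half_pos hε)), self_mem_nhdsWithin,
    Ioc_mem_nhdsGT hδ] with r h1 h2 h3
  have h2 : 0 < r := h2
  have h4 := hC r h3.1 h3.2
  have h5 : A * (ε / (2 * A)) = ε / 2 := by field_simp
  rw [Real.dist_eq, sub_zero, abs_of_nonneg (mul_nonneg (by positivity) (hT0 r h2))]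
  linarith

/-- The weighted tail integral in `tendsto_rpow_mul_tail` for a density `f` with respect to `μ`. -/
lemma tendsto_rpow_mul_integral_compl_ball {μ : Measure 𝔼} {f : 𝔼 → ℝ} (a : 𝔼) {p η : ℝ}
    (hp : 0 < p) (hη : 0 < η) (hf : ∀ x, 0 ≤ f x)
    (hN : Tendsto (fun r => (∫ x in ball a r, f x ∂μ) / r ^ p) (𝓝[>] 0) (𝓝 0))
    (hloc : ∀ r, IntegrableOn f (ball a r) μ)
    (hint : ∀ r, 0 < r →
      IntegrableOn (fun x => ‖x - a‖ ^ (-(p + η)) * f x) (ball a r)ᶜ μ) :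
    Tendsto (fun r => r ^ η * ∫ x in (ball a r)ᶜ, ‖x - a‖ ^ (-(p + η)) * f x ∂μ)
      (𝓝[>] 0) (𝓝 0) := by
  have hnn : ∀ x, 0 ≤ ‖x - a‖ ^ (-(p + η)) * f x := fun x => mul_nonneg (by positivity) (hf x)
  refine tendsto_rpow_mul_tail hη hN (fun r hr => integral_nonneg hnn) ?_ ?_
  · intro r r' hr hrr
    exact setIntegral_mono_set (hint r hr) (ae_of_all _ hnn)
      (Set.compl_subset_compl.2 (ball_subset_ball hrr)).eventuallyLE
  · intro r hr
    have hsub : ball a r ⊆ ball a (2 * r) := ball_subset_ball (by linarith)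
    have hU : (ball a r)ᶜ = (ball a (2 * r) \ ball a r) ∪ (ball a (2 * r))ᶜ := by
      ext x
      have := @hsub x
      simp only [Set.mem_compl_iff, Set.mem_union, Set.mem_sdiff]
      tauto
    have hi : IntegrableOn (fun x => ‖x - a‖ ^ (-(p + η)) * f x) (ball a (2 * r) \ ball a r) μ :=
      (hint r hr).mono_set (fun x hx => hx.2)
    rw [hU, setIntegral_union (disjoint_compl_right.mono_left Set.sdiff_subset)
      measurableSet_ball.compl hi (hint (2 * r) (by positivity))]
    gcongr
    rw [← integral_const_mul]
    calc ∫ x in ball a (2 * r) \ ball a r, ‖x - a‖ ^ (-(p + η)) * f x ∂μ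
        ≤ ∫ x in ball a (2 * r) \ ball a r, r ^ (-(p + η)) * f x ∂μ := by
          refine setIntegral_mono_on hi
            (((hloc (2 * r)).mono_set Set.sdiff_subset).const_mul _)
            (measurableSet_ball.diff measurableSet_ball) fun x hx => ?_
          have h : r ≤ ‖x - a‖ := by simpa [dist_eq_norm] using hx.2
          exact mul_le_mul_of_nonneg_right
            (Real.rpow_le_rpow_of_nonpos hr h (by linarith)) (hf x)
      _ ≤ _ := setIntegral_mono_set ((hloc (2 * r)).const_mul _)
          (ae_of_all _ fun x => mul_nonneg (by positivity) (hf x)) Set.sdiff_subset.eventuallyLE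

/-! ### Riesz potentials of bounded integrable weights -/

lemma one_le_dim (hs : 0 < s) (hsd : s < d) : 1 ≤ d := by
  have : (0 : ℝ) < d := hs.trans hsd
  exact_mod_cast this

lemma integrableOn_ball_norm_rpow (hs : 0 < s) (hsd : s < d) (ρ : ℝ) :
    IntegrableOn (fun z : 𝔼 => ‖z‖ ^ (-s)) (ball 0 ρ) := by
  refine integrableOn_ball_of_norm_le_rpow (C := 1) (α := s) ?_ ?_ ?_ ?_
  · simpa using one_le_dim hs hsd
  · simpa using hsd
  · exact ae_of_all _ fun x => by
      rw [one_mul, Real.norm_of_nonneg (by positivity)]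
  · exact Measurable.aestronglyMeasurable (by fun_prop)

lemma setIntegral_ball_norm_rpow (s : ℝ) {ρ : ℝ} (hρ : 0 < ρ) :
    ∫ z : 𝔼 in ball 0 ρ, ‖z‖ ^ (-s) = ρ ^ (d - s) * ∫ z : 𝔼 in ball 0 1, ‖z‖ ^ (-s) := by
  have h := Measure.setIntegral_comp_smul_of_pos (volume : Measure 𝔼)
    (fun z => ‖z‖ ^ (-s)) (ball 0 1) hρ
  rw [_root_.smul_ball hρ.ne', smul_zero, Real.norm_of_nonneg hρ.le, mul_one] at h
  simp only [norm_smul, Real.norm_of_nonneg hρ.le, finrank_euclideanSpace, Fintype.card_fin,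
    Real.mul_rpow hρ.le (norm_nonneg _), smul_eq_mul, integral_const_mul] at h
  rw [sub_eq_add_neg, Real.rpow_add hρ, Real.rpow_natCast, mul_assoc, h]
  field_simp

lemma integrableOn_compl_ball_norm_rpow (hd : 1 ≤ d) {t : ℝ} (ht : d < t) (a : 𝔼) {r : ℝ}
    (hr : 0 < r) : IntegrableOn (fun x : 𝔼 => ‖x - a‖ ^ (-t)) (ball a r)ᶜ := by
  have : Nonempty (Fin d) := ⟨⟨0, hd⟩⟩
  have h0 : Integrable (fun x : 𝔼 => (Set.Ici r).indicator (fun u => u ^ (-t)) ‖x‖) := by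
    rw [integrable_fun_norm_addHaar (μ := (volume : Measure 𝔼))
      (f := (Set.Ici r).indicator (fun u => u ^ (-t)))]
    have h1 : IntegrableOn (fun u : ℝ => u ^ ((d : ℝ) - 1 - t)) (Set.Ici r) := by
      rw [integrableOn_Ici_iff_integrableOn_Ioi]
      exact integrableOn_Ioi_rpow_of_lt (by linarith) hr
    rw [← integrable_indicator_iff measurableSet_Ici] at h1
    refine h1.integrableOn.congr_fun (fun u hu => ?_) measurableSet_Ioi
    have hu : 0 < u := hu
    by_cases h : u ∈ Set.Ici r
    · simp only [Set.indicator_of_mem h, finrank_euclideanSpace, Fintype.card_fin, smul_eq_mul]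
      rw [← Real.rpow_natCast, ← Real.rpow_add hu, Nat.cast_sub hd]
      simp [sub_eq_add_neg]
    · simp [Set.indicator_of_notMem h]
  rw [← integrable_indicator_iff measurableSet_ball.compl]
  refine (h0.comp_sub_right a).congr (ae_of_all _ fun x => ?_)
  by_cases h : r ≤ ‖x - a‖ <;> simp [Set.indicator, h, dist_eq_norm]

lemma integrable_indicator_ball_norm_sub_rpow (hs : 0 < s) (hsd : s < d) (ρ : ℝ) (y : 𝔼) :
    Integrable (fun x : 𝔼 => (ball 0 ρ).indicator (fun z : 𝔼 => ‖z‖ ^ (-s)) (x - y)) :=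
  ((integrable_indicator_iff measurableSet_ball).2
    (integrableOn_ball_norm_rpow hs hsd ρ)).comp_sub_right y

lemma mul_norm_sub_rpow_le (hs : 0 < s) {w M ρ : ℝ} (hw : 0 ≤ w) (hwM : w ≤ M) (hρ : 0 < ρ)
    (z : 𝔼) :
    w * ‖z‖ ^ (-s) ≤ M * (ball 0 ρ).indicator (fun z : 𝔼 => ‖z‖ ^ (-s)) z + w * ρ ^ (-s) := by
  by_cases h : z ∈ ball (0 : 𝔼) ρ
  · rw [Set.indicator_of_mem h]
    have : 0 ≤ w * ρ ^ (-s) := by positivity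
    have : w * ‖z‖ ^ (-s) ≤ M * ‖z‖ ^ (-s) := by gcongr
    linarith
  · rw [Set.indicator_of_notMem h, mul_zero, zero_add]
    have h : ρ ≤ ‖z‖ := by simpa using h
    exact mul_le_mul_of_nonneg_left (Real.rpow_le_rpow_of_nonpos hρ h (by linarith)) hw

lemma integrable_mul_norm_sub_rpow (hs : 0 < s) (hsd : s < d) {W : 𝔼 → ℝ} {M : ℝ}
    (hW : Integrable W) (hW0 : ∀ x, 0 ≤ W x) (hWM : ∀ x, W x ≤ M) (y : 𝔼) :
    Integrable (fun x => W x * ‖x - y‖ ^ (-s)) := by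
  refine Integrable.mono' (((integrable_indicator_ball_norm_sub_rpow hs hsd 1 y).const_mul M).add
    (hW.mul_const (1 ^ (-s)))) ?_ (ae_of_all _ fun x => ?_)
  · exact hW.aestronglyMeasurable.mul (Measurable.aestronglyMeasurable (by fun_prop))
  · rw [Real.norm_of_nonneg (mul_nonneg (hW0 x) (by positivity))]
    exact mul_norm_sub_rpow_le hs (hW0 x) (hWM x) one_pos (x - y)

/-- The potential of a weight that is both bounded and integrable is bounded uniformly in the
pole `y`: the singular part is controlled by the sup norm, the rest by the `L¹` norm. -/
lemma integral_mul_norm_sub_rpow_le (hs : 0 < s) (hsd : s < d) {W : 𝔼 → ℝ} {M ρ : ℝ}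
    (hW : Integrable W) (hW0 : ∀ x, 0 ≤ W x) (hWM : ∀ x, W x ≤ M) (hρ : 0 < ρ) (y : 𝔼) :
    ∫ x, W x * ‖x - y‖ ^ (-s) ≤
      M * (ρ ^ (d - s) * ∫ z : 𝔼 in ball 0 1, ‖z‖ ^ (-s)) + (∫ x, W x) * ρ ^ (-s) := by
  have h1 := (integrable_indicator_ball_norm_sub_rpow hs hsd ρ y).const_mul M
  have h2 := hW.mul_const (ρ ^ (-s))
  refine (integral_mono (integrable_mul_norm_sub_rpow hs hsd hW hW0 hWM y) (h1.add h2)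
    fun x => mul_norm_sub_rpow_le hs (hW0 x) (hWM x) hρ (x - y)).trans_eq ?_
  have h3 := integral_sub_right_eq_self (μ := volume)
    ((ball 0 ρ).indicator fun z : 𝔼 => ‖z‖ ^ (-s)) y
  rw [← setIntegral_ball_norm_rpow s hρ, ← integral_mul_const, ← integral_indicator
    measurableSet_ball, ← h3, ← integral_const_mul]
  exact integral_add h1 h2

variable {m : Measure (EuclideanSpace ℝ (Fin d))} [IsFiniteMeasure m]

/-- The form in which Tonelli's theorem is used: a bounded integrable weight makes the kernel
jointly integrable against Lebesgue measure and any finite measure. -/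
lemma integrable_prod_smul_kernel (hs : 0 < s) (hsd : s < d) {W : 𝔼 → ℝ} {M : ℝ}
    (hW : Integrable W) (hW0 : ∀ x, 0 ≤ W x) (hWM : ∀ x, W x ≤ M) :
    Integrable (fun p : 𝔼 × 𝔼 => W p.1 • kernel s (p.1 - p.2)) (volume.prod m) := by
  have hmeas : AEStronglyMeasurable (fun p : 𝔼 × 𝔼 => W p.1 • kernel s (p.1 - p.2))
      (volume.prod m) := by
    refine hW.aestronglyMeasurable.comp_fst.smul ?_
    have : Measurable fun p : 𝔼 × 𝔼 => kernel s (p.1 - p.2) := by fun_prop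
    exact this.aestronglyMeasurable
  have hnorm : ∀ x y, ‖W x • kernel s (x - y)‖ = W x * ‖x - y‖ ^ (-s) := fun x y => by
    rw [norm_smul, norm_kernel hs, Real.norm_of_nonneg (hW0 x)]
  rw [integrable_prod_iff' hmeas]
  refine ⟨ae_of_all _ fun y => ?_, ?_⟩
  · refine (integrable_mul_norm_sub_rpow hs hsd hW hW0 hWM y).mono' ?_ (ae_of_all _ fun x => ?_)
    · have : Measurable fun x : 𝔼 => kernel s (x - y) := by fun_prop
      exact hW.aestronglyMeasurable.smul this.aestronglyMeasurable
    · exact (hnorm x y).le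
  · refine Integrable.of_bound hmeas.norm.prod_swap.integral_prod_right'
      (M * (1 ^ (d - s) * ∫ z : 𝔼 in ball 0 1, ‖z‖ ^ (-s)) + (∫ x, W x) * 1 ^ (-s))
      (ae_of_all _ fun y => ?_)
    rw [Real.norm_of_nonneg (integral_nonneg fun x => norm_nonneg _)]
    simp only [hnorm]
    exact integral_mul_norm_sub_rpow_le hs hsd hW hW0 hWM one_pos y

lemma integrable_smul_V (hs : 0 < s) (hsd : s < d) {W : 𝔼 → ℝ} {M : ℝ}
    (hW : Integrable W) (hW0 : ∀ x, 0 ≤ W x) (hWM : ∀ x, W x ≤ M) :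
    Integrable (fun x => W x • V s m x) := by
  have := (integrable_prod_smul_kernel (m := m) hs hsd hW hW0 hWM).integral_prod_left
  simpa only [integral_smul, V] using this

lemma integrable_indicator_ball_one (a : 𝔼) (r : ℝ) :
    Integrable ((ball a r).indicator (1 : 𝔼 → ℝ)) :=
  (integrable_indicator_iff measurableSet_ball).2 (integrableOn_const measure_ball_lt_top.ne)

lemma indicator_one_nonneg (S : Set 𝔼) (x : 𝔼) : 0 ≤ S.indicator (1 : 𝔼 → ℝ) x :=
  Set.indicator_nonneg (fun _ _ => zero_le_one) x

lemma indicator_one_le_one (S : Set 𝔼) (x : 𝔼) : S.indicator (1 : 𝔼 → ℝ) x ≤ 1 :=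
  Set.indicator_apply_le' (fun _ => le_rfl) fun _ => zero_le_one

lemma integrableOn_ball_V (hs : 0 < s) (hsd : s < d) (a : 𝔼) (r : ℝ) :
    IntegrableOn (V s m) (ball a r) := by
  have := integrable_smul_V (m := m) hs hsd (integrable_indicator_ball_one a r)
    (indicator_one_nonneg _) (indicator_one_le_one _)
  rw [← integrable_indicator_iff measurableSet_ball]
  refine this.congr (ae_of_all _ fun x => ?_)
  by_cases h : x ∈ ball a r <;> simp [h]

/-- The radial weight `|x - a| ^ (-t)` cut off inside the ball `B_r(a)`. -/
noncomputable def tailWeight (t : ℝ) (a : 𝔼) (r : ℝ) : 𝔼 → ℝ :=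
  (ball a r)ᶜ.indicator fun x => ‖x - a‖ ^ (-t)

lemma tailWeight_nonneg (t : ℝ) (a : 𝔼) (r : ℝ) (x : 𝔼) : 0 ≤ tailWeight t a r x :=
  Set.indicator_nonneg (fun _ _ => by positivity) x

lemma tailWeight_le {t : ℝ} (ht : 0 ≤ t) (a : 𝔼) {r : ℝ} (hr : 0 < r) (x : 𝔼) :
    tailWeight t a r x ≤ r ^ (-t) := by
  refine Set.indicator_apply_le' (fun h => ?_) fun _ => by positivity
  have h : r ≤ ‖x - a‖ := by simpa [dist_eq_norm] using h
  exact Real.rpow_le_rpow_of_nonpos hr h (by linarith)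

lemma integrable_tailWeight (hd : 1 ≤ d) {t : ℝ} (ht : d < t) (a : 𝔼) {r : ℝ} (hr : 0 < r) :
    Integrable (tailWeight t a r) :=
  (integrable_indicator_iff measurableSet_ball.compl).2
    (integrableOn_compl_ball_norm_rpow hd ht a hr)

/-! ### Averages of the field and truncated integrals -/

lemma ae_integrable_kernel (hs : 0 < s) (hsd : s < d) :
    ∀ᵐ x : 𝔼, Integrable (fun y => kernel s (x - y)) m := by
  have hW : Integrable fun x : 𝔼 => (1 + ‖x‖) ^ (-((d : ℝ) + 1)) :=
    integrable_one_add_norm (by simp)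
  have hpos : ∀ x : 𝔼, 0 < (1 + ‖x‖) ^ (-((d : ℝ) + 1)) := fun x => by positivity
  have hle : ∀ x : 𝔼, (1 + ‖x‖) ^ (-((d : ℝ) + 1)) ≤ 1 := fun x =>
    Real.rpow_le_one_of_one_le_of_nonpos (by simp) (by linarith [d.cast_nonneg (α := ℝ)])
  filter_upwards [(integrable_prod_smul_kernel (m := m) hs hsd hW
    (fun x => (hpos x).le) hle).prod_right_ae] with x hx
  exact (integrable_smul_iff (hpos x).ne' _).1 hx

lemma integrableOn_compl_ball_rpow_measure (a : 𝔼) {t r : ℝ} (ht : 0 ≤ t) (hr : 0 < r) :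
    IntegrableOn (fun y => ‖y - a‖ ^ (-t)) (ball a r)ᶜ m := by
  refine Integrable.of_bound (Measurable.aestronglyMeasurable (by fun_prop)) (r ^ (-t))
    (ae_restrict_of_forall_mem measurableSet_ball.compl fun y hy => ?_)
  have hy : r ≤ ‖y - a‖ := by simpa [dist_eq_norm] using hy
  rw [Real.norm_of_nonneg (by positivity)]
  exact Real.rpow_le_rpow_of_nonpos hr hy (by linarith)

lemma integrableOn_compl_ball_kernel (hs : 0 < s) (a : 𝔼) {r : ℝ} (hr : 0 < r) :
    IntegrableOn (fun y => kernel s (a - y)) (ball a r)ᶜ m := by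
  refine (integrableOn_compl_ball_rpow_measure (m := m) a hs.le hr).mono'
    (Measurable.aestronglyMeasurable (by fun_prop)) (ae_of_all _ fun y => ?_)
  rw [norm_kernel hs, norm_sub_rev]

/-- Near `a` the field differs from the integral truncated at radius `2r` by the potential of the
mass in `B_{2r}(a)` and by an error from the variation of the kernel away from `a`. -/
lemma norm_V_sub_truncated_le (hs : 0 < s) {a x : 𝔼} {r : ℝ} (hr : 0 < r) (hx : x ∈ ball a r)
    (hint : Integrable (fun y => kernel s (x - y)) m) :
    ‖V s m x - ∫ y in (ball a (2 * r))ᶜ, kernel s (a - y) ∂m‖ ≤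
      (∫ y in ball a (2 * r), ‖x - y‖ ^ (-s) ∂m) +
        (2 ^ (s + 1) + (s + 1) * 2 ^ (s + 2)) * r *
          ∫ y in (ball a (2 * r))ᶜ, ‖y - a‖ ^ (-(s + 1)) ∂m := by
  have h2r : 0 < 2 * r := by positivity
  have hK := integrableOn_compl_ball_kernel (m := m) hs a h2r
  have hsplit : V s m x = (∫ y in ball a (2 * r), kernel s (x - y) ∂m) +
      ∫ y in (ball a (2 * r))ᶜ, kernel s (x - y) ∂m :=
    (integral_add_compl measurableSet_ball hint).symm
  rw [hsplit, add_sub_assoc, ← integral_sub hint.integrableOn hK]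
  refine (norm_add_le _ _).trans (add_le_add ?_ ?_)
  · refine (norm_integral_le_integral_norm _).trans_eq ?_
    simp only [norm_kernel hs]
  · rw [← integral_const_mul]
    refine norm_integral_le_of_norm_le
      ((integrableOn_compl_ball_rpow_measure a (by linarith) h2r).const_mul _)
      (ae_restrict_of_forall_mem measurableSet_ball.compl fun y hy => ?_)
    have hy : 2 * r ≤ ‖y - a‖ := by simpa [dist_eq_norm] using hy
    have hx : ‖x - a‖ < r := by simpa [dist_eq_norm] using hx
    have hsub : x - y - (a - y) = x - a := by abel
    have h := norm_kernel_sub_le hs (u := x - y) (v := a - y)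
      (by rw [hsub, norm_sub_rev a y]; linarith)
    rw [hsub, norm_sub_rev a y] at h
    refine h.trans ?_
    gcongr

/-- The mass in `B_{2r}(a)` contributes little on average over `B_r(a)`. -/
lemma setIntegral_potential_le (hs : 0 < s) (hsd : s < d) (a : 𝔼) {r : ℝ} (hr : 0 < r) :
    IntegrableOn (fun x => ∫ y in ball a (2 * r), ‖x - y‖ ^ (-s) ∂m) (ball a r) ∧
    ∫ x in ball a r, (∫ y in ball a (2 * r), ‖x - y‖ ^ (-s) ∂m) ≤
      m.real (ball a (2 * r)) * (r ^ (d - s) * (∫ z : 𝔼 in ball 0 1, ‖z‖ ^ (-s)) +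
        volume.real (ball a r) * r ^ (-s)) := by
  set W : 𝔼 → ℝ := (ball a r).indicator 1
  have hW : Integrable W := integrable_indicator_ball_one a r
  have hW0 : ∀ x, 0 ≤ W x := indicator_one_nonneg (ball a r)
  have hW1 : ∀ x, W x ≤ 1 := indicator_one_le_one (ball a r)
  have hprod := (integrable_prod_smul_kernel (m := m.restrict (ball a (2 * r)))
    hs hsd hW hW0 hW1).norm
  have hnorm : ∀ x y, ‖W x • kernel s (x - y)‖ = W x * ‖x - y‖ ^ (-s) := fun x y => by
    rw [norm_smul, norm_kernel hs, Real.norm_of_nonneg (hW0 x)]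
  have hind : (fun x => ∫ y in ball a (2 * r), W x * ‖x - y‖ ^ (-s) ∂m) =
      (ball a r).indicator fun x => ∫ y in ball a (2 * r), ‖x - y‖ ^ (-s) ∂m := by
    ext x
    by_cases h : x ∈ ball a r <;> simp [W, h]
  have hL := hprod.integral_prod_left
  have hswap := integral_integral_swap (f := fun x y => ‖W x • kernel s (x - y)‖) hprod
  have hR := hprod.integral_prod_right
  simp only [hnorm] at hL hswap hR
  rw [hind] at hL hswap
  refine ⟨(integrable_indicator_iff measurableSet_ball).1 hL, ?_⟩
  rw [integral_indicator measurableSet_ball] at hswap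
  rw [hswap]
  have hWint : ∫ x, W x = volume.real (ball a r) := integral_indicator_one measurableSet_ball
  calc _ ≤ ∫ _ in ball a (2 * r), (1 * (r ^ (d - s) * ∫ z : 𝔼 in ball 0 1, ‖z‖ ^ (-s)) +
        (∫ x, W x) * r ^ (-s)) ∂m :=
        integral_mono hR (integrable_const _) fun y =>
          integral_mul_norm_sub_rpow_le hs hsd hW hW0 hW1 hr y
    _ = _ := by rw [setIntegral_const, hWint, one_mul, smul_eq_mul]

lemma tendsto_const_mul_nhdsGT_zero {c : ℝ} (hc : 0 < c) :
    Tendsto (fun r : ℝ => c * r) (𝓝[>] 0) (𝓝[>] 0) := by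
  refine tendsto_nhdsWithin_iff.2 ⟨?_, ?_⟩
  · have : Tendsto (fun r : ℝ => c * r) (𝓝 0) (𝓝 (c * 0)) := tendsto_id.const_mul c
    rw [mul_zero] at this
    exact this.mono_left nhdsWithin_le_nhds
  · filter_upwards [self_mem_nhdsWithin] with r hr
    exact Set.mem_Ioi.2 (mul_pos hc hr)

lemma volume_real_ball (hd : 1 ≤ d) (a : 𝔼) {r : ℝ} (hr : 0 ≤ r) :
    volume.real (ball a r) = r ^ d * volume.real (ball (0 : 𝔼) 1) := by
  have : Nonempty (Fin d) := ⟨⟨0, hd⟩⟩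
  simp [Measure.real, Measure.addHaar_ball volume a hr, hr]

lemma volume_real_ball_pos (a : 𝔼) {r : ℝ} (hr : 0 < r) : 0 < volume.real (ball a r) :=
  ENNReal.toReal_pos (measure_ball_pos _ _ hr).ne' measure_ball_lt_top.ne

/-- If the `s`-density of `m` vanishes at `a`, then on small balls the field is close in mean to the
truncated integrals defining the principal value. -/
lemma tendsto_average_norm_V_sub_truncated (hs : 0 < s) (hsd : s < d) {a : 𝔼}
    (hm : Tendsto (fun r : ℝ => m.real (ball a r) / r ^ s) (𝓝[>] 0) (𝓝 0)) :
    Tendsto (fun r : ℝ => ⨍ x in ball a r,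
      ‖V s m x - ∫ y in (ball a (2 * r))ᶜ, kernel s (a - y) ∂m‖) (𝓝[>] 0) (𝓝 0) := by
  set C : ℝ := 2 ^ (s + 1) + (s + 1) * 2 ^ (s + 2)
  set J : ℝ := ∫ z : 𝔼 in ball 0 1, ‖z‖ ^ (-s)
  set ω : ℝ := volume.real (ball (0 : 𝔼) 1)
  have hω : 0 < ω := volume_real_ball_pos 0 one_pos
  set T : ℝ → ℝ := fun r => ∫ y in (ball a r)ᶜ, ‖y - a‖ ^ (-(s + 1)) ∂m
  have hT : Tendsto (fun r => r * T r) (𝓝[>] 0) (𝓝 0) := by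
    have := tendsto_rpow_mul_integral_compl_ball (μ := m) (f := fun _ => 1) a (p := s) hs one_pos
      (fun _ => zero_le_one) (by simpa using hm) (fun r => integrableOn_const (measure_ne_top _ _))
      (fun r hr => by
        simpa using integrableOn_compl_ball_rpow_measure (m := m) a (t := s + 1) (by linarith) hr)
    simpa only [mul_one, Real.rpow_one] using this
  have hlim := ((hm.comp (tendsto_const_mul_nhdsGT_zero two_pos)).mul_const (2 ^ s * (J / ω + 1))).add
    ((hT.comp (tendsto_const_mul_nhdsGT_zero two_pos)).mul_const (C / 2))
  simp only [zero_mul, add_zero] at hlim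
  refine tendsto_of_tendsto_of_tendsto_of_le_of_le' tendsto_const_nhds hlim
    (Eventually.of_forall fun r => ?_) ?_
  · rw [setAverage_eq]
    exact smul_nonneg (by positivity) (integral_nonneg fun x => norm_nonneg _)
  filter_upwards [self_mem_nhdsWithin] with r hr
  have hr : 0 < r := hr
  obtain ⟨hUi, hU⟩ := setIntegral_potential_le (m := m) hs hsd a hr
  have hvol : volume.real (ball a r) = r ^ d * ω := volume_real_ball (one_le_dim hs hsd) a hr.le
  have hvpos := volume_real_ball_pos a hr
  set v := volume.real (ball a r)
  rw [setAverage_eq, smul_eq_mul, inv_mul_le_iff₀ hvpos]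
  have hconst : IntegrableOn (fun _ : 𝔼 => C * r * T (2 * r)) (ball a r) :=
    integrableOn_const measure_ball_lt_top.ne
  calc ∫ x in ball a r, ‖V s m x - ∫ y in (ball a (2 * r))ᶜ, kernel s (a - y) ∂m‖
      ≤ ∫ x in ball a r, ((∫ y in ball a (2 * r), ‖x - y‖ ^ (-s) ∂m) + C * r * T (2 * r)) := by
        refine integral_mono_ae ((integrableOn_ball_V hs hsd a r).sub
          (integrableOn_const measure_ball_lt_top.ne)).norm (hUi.add hconst) ?_
        filter_upwards [ae_restrict_mem measurableSet_ball,
          ae_restrict_of_ae (ae_integrable_kernel (m := m) hs hsd)] with x hx hx'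
        exact norm_V_sub_truncated_le hs hr hx hx'
    _ = (∫ x in ball a r, ∫ y in ball a (2 * r), ‖x - y‖ ^ (-s) ∂m) +
          v * (C * r * T (2 * r)) := by
        rw [integral_add hUi hconst, setIntegral_const, smul_eq_mul]
    _ ≤ m.real (ball a (2 * r)) * (r ^ (d - s) * J + v * r ^ (-s)) +
          v * (C * r * T (2 * r)) := by gcongr
    _ = _ := by
        have e : r ^ ((d : ℝ) - s) = r ^ d / r ^ s := by
          rw [Real.rpow_sub hr, Real.rpow_natCast]
        simp only [Function.comp]
        rw [hvol, e, Real.rpow_neg hr.le, Real.mul_rpow zero_le_two hr.le]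
        field_simp

/-! ### Positivity of the radial test field -/

open EuclideanGeometry in
lemma abs_det_fderiv_inversion (c : 𝔼) {R : ℝ} (x : 𝔼) :
    |((R / dist x c) ^ 2 • ((ℝ ∙ (x - c))ᗮ.reflection : 𝔼 →L[ℝ] 𝔼)).det| =
      (R / dist x c) ^ (2 * d) := by
  have h : LinearMap.det (((ℝ ∙ (x - c))ᗮ.reflection : 𝔼 →L[ℝ] 𝔼) : 𝔼 →ₗ[ℝ] 𝔼) =
      (-1) ^ Module.finrank ℝ ((ℝ ∙ (x - c))ᗮ)ᗮ :=
    Submodule.det_reflection _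
  rw [ContinuousLinearMap.det, ContinuousLinearMap.toLinearMap_smul, LinearMap.det_smul, h, abs_mul,
    abs_neg_one_pow, mul_one, finrank_euclideanSpace, Fintype.card_fin,
    abs_of_nonneg (by positivity), ← pow_mul]

/-- The pairing of the radial field `|x - a| ^ (-(2d - s + 1)) (x - a)` with the kernel of pole `y`.
The exponent makes it odd under inversion in the sphere with diameter `[a, y]`, see
`radialPairing_inversion`. -/
noncomputable def radialPairing (s : ℝ) (a y x : 𝔼) : ℝ :=
  ‖x - a‖ ^ (-(d + (d - s) + 1)) * inner ℝ (x - a) (kernel s (x - y))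

lemma radialPairing_eq (s : ℝ) (a y x : 𝔼) :
    radialPairing s a y x =
      ‖x - a‖ ^ (-(d + (d - s) + 1)) * ‖x - y‖ ^ (-(s + 1)) * inner ℝ (x - a) (x - y) := by
  rw [radialPairing, kernel, inner_smul_right, Real.rpow_neg (norm_nonneg (x - y)), mul_assoc]

lemma inner_sub_sub_eq_dist_midpoint (a y x : 𝔼) :
    inner ℝ (x - a) (x - y) = dist x (midpoint ℝ a y) ^ 2 - dist a (midpoint ℝ a y) ^ 2 := by
  set c := midpoint ℝ a y
  have h2 : (2 : ℝ) • c = a + y := by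
    simp [c, midpoint_eq_smul_add]
  have hy : y = (2 : ℝ) • c - a := by rw [h2]; abel
  have e1 : x - a = (x - c) - (a - c) := by abel
  have e2 : x - y = (x - c) + (a - c) := by rw [hy]; module
  rw [e1, e2, dist_eq_norm, dist_eq_norm]
  generalize x - c = u
  generalize a - c = w
  rw [inner_add_right, inner_sub_left, inner_sub_left,
    real_inner_self_eq_norm_sq, real_inner_self_eq_norm_sq, real_inner_comm u w]
  ring

section Inversion

open EuclideanGeometry

variable {a y x : EuclideanSpace ℝ (Fin d)}

lemma norm_inversion_sub {c z : 𝔼} (hx : x ≠ c) (hz : z ≠ c) :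
    ‖inversion c (dist z c) x - z‖ = dist z c / dist x c * ‖x - z‖ := by
  have hz' : dist z c ≠ 0 := dist_ne_zero.2 hz
  have h := dist_inversion_inversion hx hz (dist z c)
  rw [inversion_dist_center] at h
  rw [← dist_eq_norm, h, dist_eq_norm x z]
  field_simp

lemma norm_inversion_midpoint_sub_left (hya : y ≠ a) (hx : x ≠ midpoint ℝ a y) :
    ‖inversion (midpoint ℝ a y) (dist a (midpoint ℝ a y)) x - a‖ =
      dist a (midpoint ℝ a y) / dist x (midpoint ℝ a y) * ‖x - a‖ :=
  norm_inversion_sub hx fun h => hya ((left_eq_midpoint_iff _).1 h).symm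

lemma norm_inversion_midpoint_sub_right (hya : y ≠ a) (hx : x ≠ midpoint ℝ a y) :
    ‖inversion (midpoint ℝ a y) (dist a (midpoint ℝ a y)) x - y‖ =
      dist a (midpoint ℝ a y) / dist x (midpoint ℝ a y) * ‖x - y‖ := by
  have h : dist a (midpoint ℝ a y) = dist y (midpoint ℝ a y) := by
    rw [dist_left_midpoint, dist_right_midpoint]
  rw [h]
  exact norm_inversion_sub hx fun h => hya ((right_eq_midpoint_iff _).1 h).symm

/-- The radial pairing, as a density, changes sign under inversion in the sphere with
diameter `[a, y]`. -/
lemma radialPairing_inversion (hya : y ≠ a) (hx : x ≠ midpoint ℝ a y) :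
    (dist a (midpoint ℝ a y) / dist x (midpoint ℝ a y)) ^ (2 * d) *
      radialPairing s a y (inversion (midpoint ℝ a y) (dist a (midpoint ℝ a y)) x) =
      -radialPairing s a y x := by
  have hR : 0 < dist a (midpoint ℝ a y) :=
    dist_pos.2 fun h => hya ((left_eq_midpoint_iff _).1 h).symm
  have hD : 0 < dist x (midpoint ℝ a y) := dist_pos.2 hx
  rw [radialPairing_eq, radialPairing_eq, norm_inversion_midpoint_sub_left hya hx,
    norm_inversion_midpoint_sub_right hya hx, inner_sub_sub_eq_dist_midpoint,
    inner_sub_sub_eq_dist_midpoint, dist_inversion_center]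
  set R := dist a (midpoint ℝ a y)
  set D := dist x (midpoint ℝ a y)
  have hk : 0 < R / D := by positivity
  have hk1 : (R / D) ^ (2 * d) * (R / D) ^ (-(d + (d - s) + 1)) * (R / D) ^ (-(s + 1)) *
      (R / D) ^ 2 = 1 := by
    rw [← Real.rpow_natCast, ← Real.rpow_natCast, ← Real.rpow_add hk, ← Real.rpow_add hk,
      ← Real.rpow_add hk]
    convert Real.rpow_zero (R / D) using 2
    push_cast
    ring
  have hk2 : (R ^ 2 / D) ^ 2 - R ^ 2 = -((R / D) ^ 2 * (D ^ 2 - R ^ 2)) := by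
    field_simp
    ring
  rw [Real.mul_rpow hk.le (norm_nonneg _), Real.mul_rpow hk.le (norm_nonneg _), hk2]
  linear_combination (-(‖x - a‖ ^ (-(d + (d - s) + 1)) * ‖x - y‖ ^ (-(s + 1)) *
    (D ^ 2 - R ^ 2))) * hk1

end Inversion

lemma norm_sub_rpow_mul_norm_sub {t : ℝ} {a : 𝔼} {r : ℝ} (hr : 0 < r) {x : 𝔼}
    (hx : x ∈ (ball a r)ᶜ) : ‖x - a‖ ^ (-(t + 1)) * ‖x - a‖ = ‖x - a‖ ^ (-t) := by
  have hx : r ≤ ‖x - a‖ := by simpa [dist_eq_norm] using hx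
  rw [← Real.rpow_add_one (hr.trans_le hx).ne']
  congr 1
  ring

lemma abs_indicator_radialPairing_le (hs : 0 < s) (a y : 𝔼) {r : ℝ} (hr : 0 < r) (x : 𝔼) :
    ‖(ball a r)ᶜ.indicator (radialPairing s a y) x‖ ≤
      tailWeight (d + (d - s)) a r x * ‖x - y‖ ^ (-s) := by
  by_cases h : x ∈ (ball a r)ᶜ
  · rw [tailWeight, Set.indicator_of_mem h, Set.indicator_of_mem h, radialPairing, norm_mul,
      Real.norm_of_nonneg (by positivity), ← norm_sub_rpow_mul_norm_sub (t := d + (d - s)) hr h, mul_assoc,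
      ← norm_kernel hs (x - y)]
    exact mul_le_mul_of_nonneg_left (norm_inner_le_norm (𝕜 := ℝ) _ _) (by positivity)
  · simp [tailWeight, Set.indicator_of_notMem h]

lemma integrable_indicator_radialPairing (hs : 0 < s) (hsd : s < d) (a y : 𝔼) {r : ℝ}
    (hr : 0 < r) : Integrable ((ball a r)ᶜ.indicator (radialPairing s a y)) := by
  have hq : (d : ℝ) < d + (d - s) := by linarith
  refine (integrable_mul_norm_sub_rpow hs hsd
    (integrable_tailWeight (one_le_dim hs hsd) hq a hr) (tailWeight_nonneg _ a r)
    (tailWeight_le (by linarith [hs.trans hsd]) a hr) y).mono' ?_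
    (ae_of_all _ (abs_indicator_radialPairing_le hs a y hr))
  refine (Measurable.indicator ?_ measurableSet_ball.compl).aestronglyMeasurable
  unfold radialPairing
  fun_prop

open EuclideanGeometry in
/-- Testing the kernel of any pole `y` against the radial field outside a ball gives a nonnegative
number. Inversion in the sphere with diameter `[a, y]` cancels the region where the integrand is
negative, namely the inside of that sphere, against part of the outside: it moves outside points
closer to `a`, so the image of the outside loses more to the cut-off. -/
lemma integral_indicator_radialPairing_nonneg (hs : 0 < s) (hsd : s < d) (a y : 𝔼) {r : ℝ}
    (hr : 0 < r) : 0 ≤ ∫ x, (ball a r)ᶜ.indicator (radialPairing s a y) x := by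
  rcases eq_or_ne y a with rfl | hya
  · refine integral_nonneg fun x => Set.indicator_nonneg (fun x _ => ?_) x
    rw [radialPairing_eq]
    exact mul_nonneg (by positivity) real_inner_self_nonneg
  have hd := one_le_dim hs hsd
  have : Nonempty (Fin d) := ⟨⟨0, hd⟩⟩
  set c := midpoint ℝ a y with hc
  set R := dist a c with hRdef
  have hR : 0 < R := dist_pos.2 fun h => hya ((left_eq_midpoint_iff _).1 h).symm
  set S : Set 𝔼 := (ball a r)ᶜ
  set g := radialPairing s a y
  have hgi : Integrable (S.indicator g) := integrable_indicator_radialPairing hs hsd a y hr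
  have himg : inversion c R '' {c}ᶜ = {c}ᶜ := by
    rw [Set.image_compl_eq (inversion_bijective c hR.ne'), Set.image_singleton, inversion_self]
  have hder : ∀ x ∈ ({c}ᶜ : Set 𝔼), HasFDerivWithinAt (inversion c R)
      ((R / dist x c) ^ 2 • ((ℝ ∙ (x - c))ᗮ.reflection : 𝔼 →L[ℝ] 𝔼)) {c}ᶜ x := fun x hx =>
    (hasFDerivAt_inversion hx).hasFDerivWithinAt
  have hms : MeasurableSet ({c}ᶜ : Set 𝔼) := (measurableSet_singleton c).compl
  have hinj : Set.InjOn (inversion c R) {c}ᶜ := (inversion_injective c hR.ne').injOn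
  -- The Jacobian `(R / |x - c|) ^ (2d)` cancels against the scaling of the pairing, so the cut-off is
  -- all that changes, apart from the sign.
  have htrans : ∀ x ∈ ({c}ᶜ : Set 𝔼),
      |((R / dist x c) ^ 2 • ((ℝ ∙ (x - c))ᗮ.reflection : 𝔼 →L[ℝ] 𝔼)).det| •
        S.indicator g (inversion c R x) =
        -S.indicator (fun _ => g x) (inversion c R x) := by
    intro x hx
    rw [abs_det_fderiv_inversion, smul_eq_mul]
    by_cases h : inversion c R x ∈ S
    · rw [Set.indicator_of_mem h, Set.indicator_of_mem h]
      exact radialPairing_inversion hya hx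
    · simp [Set.indicator_of_notMem h]
  have hi : IntegrableOn (fun x => S.indicator (fun _ => g x) (inversion c R x)) {c}ᶜ := by
    have h := (integrableOn_image_iff_integrableOn_abs_det_fderiv_smul volume hms hder hinj
      (S.indicator g)).1 (by rw [himg]; exact hgi.integrableOn)
    refine (h.congr_fun htrans hms).neg.congr_fun (fun x _ => ?_) hms
    simp
  have heq : ∫ x in {c}ᶜ, S.indicator g x =
      -∫ x in {c}ᶜ, S.indicator (fun _ => g x) (inversion c R x) := by
    have h := integral_image_eq_integral_abs_det_fderiv_smul volume hms hder hinj (S.indicator g)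
    rw [himg, setIntegral_congr_fun hms htrans, integral_neg] at h
    exact h
  rw [← restrict_compl_singleton (μ := (volume : Measure 𝔼)) c]
  have hsum : 0 ≤ ∫ x in {c}ᶜ, (S.indicator g x - S.indicator (fun _ => g x) (inversion c R x)) := by
    refine setIntegral_nonneg hms fun x hx => ?_
    have hD : 0 < dist x c := dist_pos.2 hx
    have hnorm : ‖inversion c R x - a‖ = R / dist x c * ‖x - a‖ :=
      norm_inversion_midpoint_sub_left hya hx
    have hg : g x = ‖x - a‖ ^ (-(d + (d - s) + 1)) * ‖x - y‖ ^ (-(s + 1)) *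
        (dist x c ^ 2 - R ^ 2) := by
      rw [← inner_sub_sub_eq_dist_midpoint]
      exact radialPairing_eq s a y x
    have hmem : ∀ z : 𝔼, z ∈ S ↔ r ≤ ‖z - a‖ := fun z => by simp [S, dist_eq_norm]
    rcases le_total R (dist x c) with h | h
    · have hg0 : 0 ≤ g x := by
        rw [hg]
        exact mul_nonneg (by positivity) (sub_nonneg.2 (by gcongr))
      have hle : ‖inversion c R x - a‖ ≤ ‖x - a‖ := by
        rw [hnorm]
        exact mul_le_of_le_one_left (norm_nonneg _) ((div_le_one hD).2 h)
      by_cases h1 : inversion c R x ∈ S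
      · have h2 : x ∈ S := (hmem x).2 (((hmem _).1 h1).trans hle)
        simp [h1, h2]
      · rw [Set.indicator_of_notMem h1, sub_zero]
        exact Set.indicator_apply_nonneg fun _ => hg0
    · have hg0 : g x ≤ 0 := by
        rw [hg]
        exact mul_nonpos_of_nonneg_of_nonpos (by positivity) (sub_nonpos.2 (by gcongr))
      have hle : ‖x - a‖ ≤ ‖inversion c R x - a‖ := by
        rw [hnorm]
        exact le_mul_of_one_le_left (norm_nonneg _) ((one_le_div hD).2 h)
      by_cases h1 : x ∈ S
      · have h2 : inversion c R x ∈ S := (hmem _).2 (((hmem _).1 h1).trans hle)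
        simp [h1, h2]
      · rw [Set.indicator_of_notMem h1, zero_sub, neg_nonneg]
        exact Set.indicator_apply_nonpos fun _ => hg0
  rw [integral_sub hgi.integrableOn hi] at hsum
  linarith

/-- For poles deep inside the ball the nonnegative quantity of
`integral_indicator_radialPairing_nonneg` has a lower bound of the order dictated by scaling. -/
lemma exists_le_integral_indicator_radialPairing (hs : 0 < s) (hsd : s < d) :
    ∃ c > 0, ∀ (a y : 𝔼) (r : ℝ), 0 < r → y ∈ ball a (r / 2) →
      c / r ^ d ≤ ∫ x, (ball a r)ᶜ.indicator (radialPairing s a y) x := by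
  have hd := one_le_dim hs hsd
  set ω : ℝ := volume.real (ball (0 : 𝔼) 1)
  have hω : 0 < ω := volume_real_ball_pos 0 one_pos
  refine ⟨2 ^ (-(s + 1)) / 2 * (2 ^ (2 * d))⁻¹ * ω, by positivity, fun a y r hr hy => ?_⟩
  have hy : ‖y - a‖ < r / 2 := by simpa [dist_eq_norm] using hy
  set κ : ℝ := 2 ^ (-(s + 1)) / 2 * ((2 * r) ^ (2 * d))⁻¹
  have hinner : ∀ x ∈ (ball a r)ᶜ, ‖x - a‖ ^ 2 / 2 ≤ inner ℝ (x - a) (x - y) := by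
    intro x hx
    have hx : r ≤ ‖x - a‖ := by simpa [dist_eq_norm] using hx
    have e : x - y = (x - a) - (y - a) := by abel
    rw [e, inner_sub_right, real_inner_self_eq_norm_sq]
    have := real_inner_le_norm (x - a) (y - a)
    nlinarith [norm_nonneg (x - a)]
  have hpos : ∀ x, 0 ≤ (ball a r)ᶜ.indicator (radialPairing s a y) x := by
    refine fun x => Set.indicator_nonneg (fun x hx => ?_) x
    rw [radialPairing_eq]
    exact mul_nonneg (by positivity) (le_trans (by positivity) (hinner x hx))
  have hann : ∀ x ∈ ball a (2 * r) \ ball a r,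
      κ ≤ (ball a r)ᶜ.indicator (radialPairing s a y) x := by
    intro x hx
    rw [Set.indicator_of_mem hx.2, radialPairing_eq]
    have hin := hinner x hx.2
    have h1 : r ≤ ‖x - a‖ := by simpa [dist_eq_norm] using hx.2
    have h2 : ‖x - a‖ < 2 * r := by simpa [dist_eq_norm] using hx.1
    have h3 : ‖x - y‖ ≤ 2 * ‖x - a‖ := by
      have := norm_sub_le (x - a) (y - a)
      rw [sub_sub_sub_cancel_right] at this
      linarith
    have h4 : 0 < ‖x - y‖ := by
      have := norm_sub_norm_le (x - a) (y - a)
      rw [sub_sub_sub_cancel_right] at this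
      linarith
    have h0 : 0 < ‖x - a‖ := by linarith
    have hexp : ‖x - a‖ ^ (-(d + (d - s) + 1)) * ‖x - a‖ ^ (-(s + 1)) * ‖x - a‖ ^ 2 =
        (‖x - a‖ ^ (2 * d))⁻¹ := by
      rw [← Real.rpow_natCast, ← Real.rpow_natCast, ← Real.rpow_add h0, ← Real.rpow_add h0,
        ← Real.rpow_neg h0.le]
      congr 1
      push_cast
      ring
    calc κ ≤ 2 ^ (-(s + 1)) / 2 * (‖x - a‖ ^ (2 * d))⁻¹ := by
          simp only [κ]
          gcongr
      _ = ‖x - a‖ ^ (-(d + (d - s) + 1)) * (2 * ‖x - a‖) ^ (-(s + 1)) * (‖x - a‖ ^ 2 / 2) := by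
          rw [Real.mul_rpow zero_le_two h0.le, ← hexp]
          ring
      _ ≤ _ := by
          gcongr ?_ * ?_ * ?_
          exact Real.rpow_le_rpow_of_nonpos h4 h3 (by linarith)
  have hi := integrable_indicator_radialPairing hs hsd a y hr
  have hvol : r ^ d * ω ≤ volume.real (ball a (2 * r) \ ball a r) := by
    rw [measureReal_sdiff (ball_subset_ball (by linarith)) measurableSet_ball,
      volume_real_ball hd a hr.le, volume_real_ball hd a (by positivity), mul_pow]
    have : (2 : ℝ) ≤ 2 ^ d := le_self_pow₀ (by norm_num) (by omega)
    have h : 0 < r ^ d * ω := by positivity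
    nlinarith
  calc 2 ^ (-(s + 1)) / 2 * (2 ^ (2 * d))⁻¹ * ω / r ^ d = (r ^ d * ω) * κ := by
        simp only [κ, mul_pow, two_mul d, pow_add]
        field_simp
    _ ≤ volume.real (ball a (2 * r) \ ball a r) * κ := by
        gcongr
    _ = ∫ x in ball a (2 * r) \ ball a r, κ := by rw [setIntegral_const, smul_eq_mul]
    _ ≤ ∫ x in ball a (2 * r) \ ball a r, (ball a r)ᶜ.indicator (radialPairing s a y) x :=
        setIntegral_mono_on
          (integrableOn_const ((measure_mono Set.sdiff_subset).trans_lt measure_ball_lt_top).ne)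
          hi.integrableOn (measurableSet_ball.diff measurableSet_ball) hann
    _ ≤ _ := setIntegral_le_integral hi (ae_of_all _ hpos)

/-! ### Lebesgue points have vanishing density -/

lemma integrable_prod_radialPairing (hs : 0 < s) (hsd : s < d) (a : 𝔼) {r : ℝ} (hr : 0 < r) :
    Integrable (fun p : 𝔼 × 𝔼 => (ball a r)ᶜ.indicator (radialPairing s a p.2) p.1)
      (volume.prod m) := by
  have hq : (d : ℝ) < d + (d - s) := by linarith
  have hprod := integrable_prod_smul_kernel (m := m) hs hsd
    (integrable_tailWeight (one_le_dim hs hsd) hq a hr) (tailWeight_nonneg _ a r)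
    (tailWeight_le (by linarith [hs.trans hsd]) a hr)
  refine hprod.mono ?_ (ae_of_all _ fun p => ?_)
  · have hset : MeasurableSet ((fun p : 𝔼 × 𝔼 => p.1) ⁻¹' (ball a r)ᶜ) :=
      measurableSet_ball.compl.preimage measurable_fst
    have : Measurable fun p : 𝔼 × 𝔼 => radialPairing s a p.2 p.1 := by
      unfold radialPairing
      fun_prop
    exact (this.indicator hset).aestronglyMeasurable
  · refine (abs_indicator_radialPairing_le hs a p.2 hr p.1).trans_eq ?_
    rw [norm_smul, norm_kernel hs, Real.norm_of_nonneg (tailWeight_nonneg _ _ _ _)]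

/-- Outside a ball the radial field pairs to zero with constants, being odd about the center. -/
lemma integral_tailWeight_mul_inner_const (t : ℝ) (a : 𝔼) (r : ℝ) (α : 𝔼) :
    ∫ x, tailWeight t a r x * inner ℝ (x - a) α = 0 := by
  have h := integral_sub_left_eq_self (μ := (volume : Measure 𝔼))
    (fun x => tailWeight t a r x * inner ℝ (x - a) α) (a + a)
  have hodd : ∀ x, tailWeight t a r (a + a - x) * inner ℝ (a + a - x - a) α =
      -(tailWeight t a r x * inner ℝ (x - a) α) := by
    intro x
    have e : a + a - x - a = -(x - a) := by abel
    have hw : tailWeight t a r (a + a - x) = tailWeight t a r x := by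
      simp only [tailWeight, Set.indicator, Set.mem_compl_iff, mem_ball, dist_eq_norm, e, norm_neg]
    rw [hw, e, inner_neg_left, mul_neg]
  simp only [hodd, integral_neg] at h
  linarith

lemma integrableOn_compl_ball_rpow_mul_norm_V_sub (hs : 0 < s) (hsd : s < d) (a α : 𝔼) {r : ℝ}
    (hr : 0 < r) :
    IntegrableOn (fun x => ‖x - a‖ ^ (-(d + (d - s))) * ‖V s m x - α‖) (ball a r)ᶜ := by
  have hd := one_le_dim hs hsd
  have hq : (d : ℝ) < d + (d - s) := by linarith
  have hi := (integrable_smul_V (m := m) hs hsd (integrable_tailWeight hd hq a hr)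
    (tailWeight_nonneg _ a r) (tailWeight_le (by linarith [hs.trans hsd]) a hr)).sub
    ((integrable_tailWeight hd hq a hr).smul_const α)
  rw [← integrable_indicator_iff measurableSet_ball.compl]
  refine hi.norm.congr (ae_of_all _ fun x => ?_)
  by_cases h : x ∈ (ball a r)ᶜ
  · simp only [tailWeight, Set.indicator_of_mem h, Pi.sub_apply, ← smul_sub]
    rw [norm_smul, Real.norm_of_nonneg (by positivity)]
  · simp [tailWeight, Set.indicator_of_notMem h]

/-- Testing the field against the radial field outside `B_r(a)` detects the mass in
`B_{r/2}(a)` from below and the oscillation of the field from above. -/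
lemma exists_mul_measureReal_ball_le (hs : 0 < s) (hsd : s < d) :
    ∃ c > 0, ∀ (a α : 𝔼) (r : ℝ), 0 < r →
      c / r ^ d * m.real (ball a (r / 2)) ≤
        ∫ x in (ball a r)ᶜ, ‖x - a‖ ^ (-(d + (d - s))) * ‖V s m x - α‖ := by
  obtain ⟨c, hc, hle⟩ := exists_le_integral_indicator_radialPairing hs hsd
  refine ⟨c, hc, fun a α r hr => ?_⟩
  have hd := one_le_dim hs hsd
  have hq : (d : ℝ) < d + (d - s) := by linarith
  have hprod := integrable_prod_radialPairing (m := m) hs hsd a hr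
  have hG := hprod.integral_prod_right
  have hswap := integral_integral_swap
    (f := fun x y => (ball a r)ᶜ.indicator (radialPairing s a y) x) hprod
  have hL := hprod.integral_prod_left
  have hinner : (fun x => ∫ y, (ball a r)ᶜ.indicator (radialPairing s a y) x ∂m) =ᵐ[volume]
      fun x => tailWeight (d + (d - s) + 1) a r x * inner ℝ (x - a) (V s m x) := by
    filter_upwards [ae_integrable_kernel (m := m) hs hsd] with x hx
    by_cases h : x ∈ (ball a r)ᶜ
    · simp only [tailWeight, Set.indicator_of_mem h, radialPairing, V]
      rw [integral_const_mul, integral_inner hx]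
    · simp only [tailWeight, Set.indicator_of_notMem h, integral_zero, zero_mul]
  have hconst_int : Integrable fun x => tailWeight (d + (d - s) + 1) a r x * inner ℝ (x - a) α := by
    refine ((integrable_tailWeight hd hq a hr).mul_const ‖α‖).mono' ?_ (ae_of_all _ fun x => ?_)
    · exact (integrable_tailWeight hd (by linarith) a hr).aestronglyMeasurable.mul
        (Measurable.aestronglyMeasurable (by fun_prop))
    · by_cases h : x ∈ (ball a r)ᶜ
      · simp only [tailWeight, Set.indicator_of_mem h]
        rw [norm_mul, Real.norm_of_nonneg (by positivity), ← norm_sub_rpow_mul_norm_sub (t := d + (d - s)) hr h,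
          mul_assoc]
        exact mul_le_mul_of_nonneg_left (norm_inner_le_norm (𝕜 := ℝ) _ _) (by positivity)
      · simp [tailWeight, Set.indicator_of_notMem h]
  calc c / r ^ d * m.real (ball a (r / 2))
      = ∫ _ in ball a (r / 2), c / r ^ d ∂m := by
        rw [setIntegral_const, smul_eq_mul, mul_comm]
    _ ≤ ∫ y in ball a (r / 2), (∫ x, (ball a r)ᶜ.indicator (radialPairing s a y) x) ∂m :=
        setIntegral_mono_on (integrableOn_const (measure_ne_top _ _)) hG.integrableOn
          measurableSet_ball fun y hy => hle a y r hr hy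
    _ ≤ ∫ y, (∫ x, (ball a r)ᶜ.indicator (radialPairing s a y) x) ∂m :=
        setIntegral_le_integral hG
          (ae_of_all _ fun y => integral_indicator_radialPairing_nonneg hs hsd a y hr)
    _ = ∫ x, tailWeight (d + (d - s) + 1) a r x * inner ℝ (x - a) (V s m x) := by
        rw [← hswap]
        exact integral_congr_ae hinner
    _ = ∫ x, tailWeight (d + (d - s) + 1) a r x * inner ℝ (x - a) (V s m x - α) := by
        simp only [inner_sub_right, mul_sub]
        rw [integral_sub (hL.congr hinner) hconst_int, integral_tailWeight_mul_inner_const,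
          sub_zero]
    _ ≤ ∫ x, (ball a r)ᶜ.indicator
          (fun x => ‖x - a‖ ^ (-(d + (d - s))) * ‖V s m x - α‖) x := by
        refine integral_mono ?_ ((integrable_indicator_iff measurableSet_ball.compl).2
          (integrableOn_compl_ball_rpow_mul_norm_V_sub hs hsd a α hr)) fun x => ?_
        · simp only [inner_sub_right, mul_sub]
          exact (hL.congr hinner).sub hconst_int
        · by_cases h : x ∈ (ball a r)ᶜ
          · simp only [tailWeight, Set.indicator_of_mem h]
            rw [← norm_sub_rpow_mul_norm_sub (t := d + (d - s)) hr h, mul_assoc]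
            gcongr
            exact real_inner_le_norm _ _
          · simp [tailWeight, Set.indicator_of_notMem h]
    _ = _ := integral_indicator measurableSet_ball.compl

lemma tendsto_measureReal_ball_div_rpow (hs : 0 < s) (hsd : s < d) {a α : 𝔼}
    (h : HasPreciseRepresentative (V s m) a α) :
    Tendsto (fun r : ℝ => m.real (ball a r) / r ^ s) (𝓝[>] 0) (𝓝 0) := by
  have hd := one_le_dim hs hsd
  have hN : Tendsto (fun r => (∫ x in ball a r, ‖V s m x - α‖) / r ^ (d : ℝ)) (𝓝[>] 0) (𝓝 0) := by
    have h2 := h.2.mul_const (volume.real (ball (0 : 𝔼) 1))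
    rw [zero_mul] at h2
    refine h2.congr' ?_
    filter_upwards [self_mem_nhdsWithin] with r hr
    have hr : 0 < r := hr
    have hω := volume_real_ball_pos (0 : 𝔼) one_pos
    rw [setAverage_eq, volume_real_ball hd a hr.le, Real.rpow_natCast, smul_eq_mul]
    field_simp
  have hT := tendsto_rpow_mul_integral_compl_ball a (by exact_mod_cast hd)
    (sub_pos.2 hsd) (fun x => norm_nonneg _) hN
    (fun r => ((integrableOn_ball_V hs hsd a r).sub
      (integrableOn_const measure_ball_lt_top.ne)).norm)
    (fun r hr => integrableOn_compl_ball_rpow_mul_norm_V_sub hs hsd a α hr)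
  obtain ⟨c, hc, hle⟩ := exists_mul_measureReal_ball_le (m := m) hs hsd
  have hlim := ((hT.comp (tendsto_const_mul_nhdsGT_zero two_pos)).const_mul (2 ^ s / c))
  rw [mul_zero] at hlim
  refine squeeze_zero' ?_ ?_ hlim
  · filter_upwards [self_mem_nhdsWithin] with r hr
    have hr : 0 < r := hr
    positivity
  · filter_upwards [self_mem_nhdsWithin] with r hr
    have hr : 0 < r := hr
    have h2r : 0 < 2 * r := by positivity
    have h1 := hle a α (2 * r) h2r
    rw [mul_div_cancel_left₀ r two_ne_zero] at h1
    have e : (2 * r) ^ ((d : ℝ) - s) = (2 * r) ^ d / (2 ^ s * r ^ s) := by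
      rw [Real.rpow_sub h2r, Real.rpow_natCast, Real.mul_rpow zero_le_two hr.le]
    calc m.real (ball a r) / r ^ s
        = 2 ^ s / c * ((2 * r) ^ ((d : ℝ) - s) * (c / (2 * r) ^ d * m.real (ball a r))) := by
          rw [e]
          field_simp
      _ ≤ _ := by
          simp only [Function.comp]
          gcongr

/-! ### Principal values and precise representatives -/

lemma tendsto_comp_two_mul_iff {f : ℝ → 𝔼} {v : 𝔼} :
    Tendsto (fun r => f (2 * r)) (𝓝[>] 0) (𝓝 v) ↔ Tendsto f (𝓝[>] 0) (𝓝 v) := by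
  refine ⟨fun h => ?_, fun h => h.comp (tendsto_const_mul_nhdsGT_zero two_pos)⟩
  have hhalf := tendsto_const_mul_nhdsGT_zero (half_pos (one_pos (α := ℝ)))
  refine (h.comp hhalf).congr fun r => ?_
  simp only [Function.comp]
  congr 1
  ring

lemma setAverage_const_ball (a : 𝔼) {r : ℝ} (hr : 0 < r) (c : ℝ) : ⨍ _ in ball a r, c = c :=
  setAverage_const (measure_ball_pos _ _ hr).ne' measure_ball_lt_top.ne c

/-- The triangle inequality for mean distances. -/
lemma average_norm_le_add {f g h : 𝔼 → ℝ} {a : 𝔼} {r : ℝ} (hf : IntegrableOn f (ball a r))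
    (hg : IntegrableOn g (ball a r)) (hh : IntegrableOn h (ball a r))
    (hle : ∀ x, f x ≤ g x + h x) :
    ⨍ x in ball a r, f x ≤ (⨍ x in ball a r, g x) + ⨍ x in ball a r, h x := by
  simp only [setAverage_eq, smul_eq_mul]
  rw [← mul_add, ← integral_add hg hh]
  exact mul_le_mul_of_nonneg_left (integral_mono hf (hg.add hh) hle) (by positivity)

/-- Where the `s`-density of `m` vanishes, the precise representative and the principal value are
the same thing. -/
lemma hasPreciseRepresentative_iff_hasPrincipalValue (hs : 0 < s) (hsd : s < d) {a v : 𝔼}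
    (hm : Tendsto (fun r : ℝ => m.real (ball a r) / r ^ s) (𝓝[>] 0) (𝓝 0)) :
    HasPreciseRepresentative (V s m) a v ↔ HasPrincipalValue s m a v := by
  have hP := tendsto_average_norm_V_sub_truncated hs hsd hm
  set P : ℝ → 𝔼 := fun ε => ∫ y in (ball a ε)ᶜ, kernel s (a - y) ∂m
  have hVi : ∀ (r : ℝ) (β : 𝔼), IntegrableOn (fun x => ‖V s m x - β‖) (ball a r) := fun r β =>
    ((integrableOn_ball_V hs hsd a r).sub (integrableOn_const measure_ball_lt_top.ne)).norm
  have hci : ∀ (r c : ℝ), IntegrableOn (fun _ : 𝔼 => c) (ball a r) := fun r c =>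
    integrableOn_const measure_ball_lt_top.ne
  have hPV : HasPrincipalValue s m a v ↔
      Tendsto (fun r => ‖P (2 * r) - v‖) (𝓝[>] 0) (𝓝 0) := by
    rw [← tendsto_iff_norm_sub_tendsto_zero, tendsto_comp_two_mul_iff]
    rfl
  rw [hPV]
  constructor
  · rintro ⟨-, h⟩
    have hlim := hP.add h
    rw [add_zero] at hlim
    refine squeeze_zero' (Eventually.of_forall fun r => norm_nonneg _) ?_ hlim
    filter_upwards [self_mem_nhdsWithin] with r hr
    rw [← setAverage_const_ball a hr ‖P (2 * r) - v‖]
    refine average_norm_le_add (hci _ _) (hVi r _) (hVi r v) fun x => ?_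
    rw [norm_sub_rev (V s m x)]
    exact norm_sub_le_norm_sub_add_norm_sub _ _ _
  · intro h
    refine ⟨Eventually.of_forall fun r => integrableOn_ball_V hs hsd a r, ?_⟩
    have hlim := hP.add h
    rw [add_zero] at hlim
    refine squeeze_zero' (Eventually.of_forall fun r => ?_) ?_ hlim
    · rw [setAverage_eq]
      exact smul_nonneg (by positivity) (integral_nonneg fun x => norm_nonneg _)
    filter_upwards [self_mem_nhdsWithin] with r hr
    rw [← setAverage_const_ball a hr ‖P (2 * r) - v‖]
    exact average_norm_le_add (hVi r v) (hVi r _) (hci _ _) fun x =>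
      norm_sub_le_norm_sub_add_norm_sub _ _ _


end RieszField

theorem theorem1p1 (d : ℕ) (s : ℝ) (hs : 0 < s) (hsd : s < d)
    (m : Measure (EuclideanSpace ℝ (Fin d))) [IsFiniteMeasure m]
    (a : EuclideanSpace ℝ (Fin d)) :
    (RieszField.IsLebesguePoint (RieszField.V s m) a ↔
      (∃ v, RieszField.HasPrincipalValue s m a v) ∧
        Tendsto (fun r : ℝ => m.real (ball a r) / r ^ s) (𝓝[>] 0) (𝓝 0)) ∧
    (∀ α v, RieszField.HasPreciseRepresentative (RieszField.V s m) a α →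
      RieszField.HasPrincipalValue s m a v → α = v) := by
  refine ⟨⟨fun ⟨α, hα⟩ => ?_, fun ⟨⟨v, hv⟩, hm⟩ => ?_⟩, fun α v hα hv => ?_⟩
  · have hm := RieszField.tendsto_measureReal_ball_div_rpow hs hsd hα
    exact ⟨⟨α, (RieszField.hasPreciseRepresentative_iff_hasPrincipalValue hs hsd hm).1 hα⟩, hm⟩
  · exact ⟨v, (RieszField.hasPreciseRepresentative_iff_hasPrincipalValue hs hsd hm).2 hv⟩
  · have hm := RieszField.tendsto_measureReal_ball_div_rpow hs hsd hα
    have hα' := (RieszField.hasPreciseRepresentative_iff_hasPrincipalValue hs hsd hm).1 hα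
    exact tendsto_nhds_unique hα' hv
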